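/- Graphs are undirected and may have loops and parallel edges; isomorphisms are isomorphisms of such multigraphs. A graph is \emph{toroidal} if it embeds into the torus $T^2=S^1\times S^1$, i.e. its vertices can be mapped to distinct points of $T^2$ and its edges to simple curves joining the images of their ends (simple closed curves for loops), such that the curves meet each other and the images of the vertices only at their ends. The girth of a graph is the length of a shortest cycle; loops are cycles of length one and pairs of parallel edges are cycles of length two. Let $F_{11}$ be the cubic graph with vertices $A,A',B,B',1,2,\dots,8$ and the eighteen edges $$AA',\ BB',\ A8,\ A'1,\ B5,\ B'4,\ 45,\ 18,\ A2,\ A'7,\ B3,\ B'6,\ 12,\ 34,\ 56,\ 78,\ 23,\ 67.$$ Write $F_{11}\cup e$ for any graph obtained from $F_{11}$ by adding one edge in one of the following three ways: (i) subdivide an edge once by a new vertex $u$, and add a further new vertex $v$, the edge $uv$ and a loop at $v$; (ii) subdivide an edge twice by new vertices $u$ and $v$, and add a second edge $uv$; (iii) subdivide two distinct edges $e_1,e_2$ once each, by new vertices $u$ and $v$ respectively, and add the edge $uv$; the result is denoted $F_{11}\cup(e_1-e_2)$. Put $$H_1=F_{11}\cup(AA'-18),\quad H_2=F_{11}\cup(A2-67),\quad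 H_3=F_{11}\cup(23-67),\quad H_4=F_{11}\cup(A2-B'6).$$ \textbf{Proposition.} Every graph $F_{11}\cup e$ that is not isomorphic to one of $H_1,H_2,H_3,H_4$ is toroidal. Moreover, every graph $F_{11}\cup e$ of girth at least four is isomorphic to one of the ten graphs $F_{11}\cup(e_1-e_2)$ with $(e_1,e_2)$ equal to $$(AA',BB'),\ (AA',B3),\ (AA',12),\ (AA',23),\ (AA',18),\ (A2,A'7),\ (A2,B3),\ (A2,B'6),\ (A2,67),\ (23,67).$$ -/

import Mathlib

open scoped Graph

namespace CubicTorus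

/-! Graphs are Mathlib's multigraphs `Graph α β`: loops and parallel edges are allowed, because
adding an edge to a cubic graph may create them. -/

/-- Two multigraphs are isomorphic: there are bijections between the vertices and between the edges
that preserve the relation "`x` and `y` are the ends of `e`". -/
def IsIsomorphic {α β α' β' : Type*} (G : Graph α β) (H : Graph α' β') : Prop :=
  ∃ (φ : V(G) ≃ V(H)) (ψ : E(G) ≃ E(H)), ∀ (e : E(G)) (x y : V(G)),
    G.IsLink e x y ↔ H.IsLink (ψ e) (φ x) (φ y)

/-- `G` has a cycle of length `n`, meant for `1 ≤ n`: the cyclically indexed vertices are distinct,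
so are the edges, and the `i`-th edge joins the `i`-th vertex to the next one. A cycle of length
one is a loop, a cycle of length two is a pair of parallel edges. -/
def HasCycle {α β : Type*} (G : Graph α β) (n : ℕ) : Prop :=
  ∃ (v : ZMod n → α) (ε : ZMod n → β), Function.Injective v ∧ Function.Injective ε ∧
    ∀ i, G.IsLink (ε i) (v i) (v (i + 1))

/-- The length of a shortest cycle of `G`, and `⊤` if there is none. -/
noncomputable def girth {α β : Type*} (G : Graph α β) : ℕ∞ :=
  ⨅ (n : ℕ) (_ : 1 ≤ n ∧ HasCycle G n), (n : ℕ∞)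

/-- The torus `S¹ × S¹`, with `S¹ = ℝ / ℤ`. -/
abbrev Torus : Type := UnitAddCircle × UnitAddCircle

/-- An embedding of a multigraph into a topological space: distinct vertices go to distinct points,
every edge goes to a curve that joins the images of its ends and is simple (closed if the edge is a
loop), and a curve meets the images of the vertices and the other curves only at its ends. -/
structure Embedding {α β : Type*} (G : Graph α β) (X : Type*) [TopologicalSpace X] where
  /-- the image of a vertex -/
  point : V(G) → X
  /-- the image of an edge -/
  curve : E(G) → C(unitInterval, X)
  point_injective : Function.Injective point
  curve_ends : ∀ e : E(G), ∃ x y : V(G), G.IsLink e x y ∧ curve e 0 = point x ∧ curve e 1 = point y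
  curve_injOn : ∀ e, Set.InjOn (curve e) (Set.Ioo 0 1)
  curve_ne_point : ∀ e, ∀ t ∈ Set.Ioo (0 : unitInterval) 1, ∀ x, curve e t ≠ point x
  curve_ne_curve : ∀ e e', e ≠ e' → ∀ s ∈ Set.Ioo (0 : unitInterval) 1,
    ∀ t ∈ Set.Ioo (0 : unitInterval) 1, curve e s ≠ curve e' t

/-- A graph is toroidal if it embeds into the torus. -/
def Toroidal {α β : Type*} (G : Graph α β) : Prop :=
  Nonempty (Embedding G Torus)

/-- Delete from `G` the edges in `F`, add two new vertices `Sum.inr 0` and `Sum.inr 1`, and add new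
edges, indexed by `κ`, with the ends that `f` prescribes. -/
def rebuild {α β κ : Type*} (G : Graph α β) (F : Set β) (f : κ → Sym2 (α ⊕ Fin 2)) :
    Graph (α ⊕ Fin 2) (β ⊕ κ) where
  vertexSet := Sum.inl '' V(G) ∪ Set.range Sum.inr ∪ {p | ∃ k, p ∈ f k}
  edgeSet := Sum.inl '' (E(G) \ F) ∪ Set.range Sum.inr
  IsLink ε p q := match ε with
    | Sum.inl e => e ∉ F ∧ ∃ x y, G.IsLink e x y ∧ p = Sum.inl x ∧ q = Sum.inl y
    | Sum.inr k => f k = s(p, q)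
  isLink_symm := by
    rintro (e | k) -
    · exact ⟨fun p q ⟨he, x, y, h, hp, hq⟩ => ⟨he, y, x, h.symm, hq, hp⟩⟩
    · exact ⟨fun p q h => h.trans Sym2.eq_swap⟩
  eq_or_eq_of_isLink_of_isLink := by
    rintro (e | k) p q r t
    · rintro ⟨-, x, y, h, rfl, rfl⟩ ⟨-, z, w, h', rfl, rfl⟩
      rcases h.left_eq_or_eq h' with rfl | rfl <;> simp
    · intro h h'
      have h2 : s(p, q) = s(r, t) := h.symm.trans h'
      rcases Sym2.eq_iff.1 h2 with h3 | h3
      · exact Or.inl h3.1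
      · exact Or.inr h3.1
  edge_mem_iff_exists_isLink := by
    rintro (e | k)
    · constructor
      · rintro (⟨e', ⟨he, hF⟩, h⟩ | ⟨k, h⟩)
        · obtain rfl := Sum.inl.inj h
          obtain ⟨x, y, hxy⟩ := Graph.exists_isLink_of_mem_edgeSet he
          exact ⟨_, _, hF, x, y, hxy, rfl, rfl⟩
        · cases h
      · rintro ⟨p, q, hF, x, y, h, -, -⟩
        exact Or.inl ⟨e, ⟨h.edge_mem, hF⟩, rfl⟩
    · constructor
      · intro _
        obtain ⟨p, q, h⟩ := Sym2.exists.1 (⟨f k, rfl⟩ : ∃ z, f k = z)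
        exact ⟨p, q, h⟩
      · intro _
        exact Or.inr ⟨k, rfl⟩
  left_mem_of_isLink := by
    rintro (e | k) p q
    · rintro ⟨-, x, y, h, rfl, rfl⟩
      exact Or.inl (Or.inl ⟨x, h.left_mem, rfl⟩)
    · intro h
      have h' : f k = s(p, q) := h
      exact Or.inr ⟨k, by rw [h']; exact Sym2.mem_mk_left p q⟩

section AddEdge

variable {α β : Type*} (G : Graph α β)

/-- The edge `e` with ends `x` and `y` is subdivided once by the new vertex `u`; a further vertex
`v`, the edge `uv` and a loop at `v` are added. -/
def addLoop (e : β) (x y : α) : Graph (α ⊕ Fin 2) (β ⊕ Fin 4) :=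
  let u : α ⊕ Fin 2 := Sum.inr 0
  let v : α ⊕ Fin 2 := Sum.inr 1
  rebuild G {e} ![s(Sum.inl x, u), s(u, Sum.inl y), s(u, v), s(v, v)]

/-- The edge `e` with ends `x` and `y` is subdivided twice, by the new vertices `u` and `v`, and
another edge `uv` is added. -/
def addParallel (e : β) (x y : α) : Graph (α ⊕ Fin 2) (β ⊕ Fin 4) :=
  let u : α ⊕ Fin 2 := Sum.inr 0
  let v : α ⊕ Fin 2 := Sum.inr 1
  rebuild G {e} ![s(Sum.inl x, u), s(u, v), s(v, Sum.inl y), s(u, v)]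

/-- The edge `e₁` with ends `x₁` and `y₁` is subdivided by the new vertex `u`, the edge `e₂` with
ends `x₂` and `y₂` by the new vertex `v`, and the edge `uv` is added. -/
def addChord (e₁ : β) (x₁ y₁ : α) (e₂ : β) (x₂ y₂ : α) : Graph (α ⊕ Fin 2) (β ⊕ Fin 5) :=
  let u : α ⊕ Fin 2 := Sum.inr 0
  let v : α ⊕ Fin 2 := Sum.inr 1
  rebuild G {e₁, e₂}
    ![s(Sum.inl x₁, u), s(u, Sum.inl y₁), s(Sum.inl x₂, v), s(v, Sum.inl y₂), s(u, v)]

/-- Up to isomorphism, `K` is obtained from `G` by adding one edge in one of the three ways that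
keep a cubic graph cubic. -/
def IsEdgeAddition {α' β' : Type*} (K : Graph α' β') : Prop :=
  (∃ e x y, G.IsLink e x y ∧ IsIsomorphic K (addLoop G e x y)) ∨
  (∃ e x y, G.IsLink e x y ∧ IsIsomorphic K (addParallel G e x y)) ∨
  (∃ e₁ x₁ y₁ e₂ x₂ y₂, G.IsLink e₁ x₁ y₁ ∧ G.IsLink e₂ x₂ y₂ ∧ e₁ ≠ e₂ ∧
    IsIsomorphic K (addChord G e₁ x₁ y₁ e₂ x₂ y₂))

end AddEdge

/-- The twelve vertices of `F₁₁`; `n1`, …, `n8` are those labelled by the numbers `1`, …, `8`. -/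
inductive F11Vertex
  | A | A' | B | B' | n1 | n2 | n3 | n4 | n5 | n6 | n7 | n8
  deriving DecidableEq

section F11

open F11Vertex

instance : Fintype F11Vertex where
  elems := {A, A', B, B', n1, n2, n3, n4, n5, n6, n7, n8}
  complete := by intro x; cases x <;> decide

/-- The eighteen edges of `F₁₁`. -/
def F11Edges : Finset (Sym2 F11Vertex) :=
  {s(A, A'), s(B, B'), s(A, n8), s(A', n1), s(B, n5), s(B', n4), s(n4, n5), s(n1, n8),
   s(A, n2), s(A', n7), s(B, n3), s(B', n6), s(n1, n2), s(n3, n4), s(n5, n6), s(n7, n8),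
   s(n2, n3), s(n6, n7)}

/-- The cubic projective plane obstruction `F₁₁`; its edges are labelled by their pairs of ends. -/
def F11 : Graph F11Vertex (Sym2 F11Vertex) :=
  Graph.ofSimpleGraph (SimpleGraph.fromEdgeSet (F11Edges : Set (Sym2 F11Vertex)))

/-- The graph `F₁₁ ∪ (x₁y₁ - x₂y₂)`: a new edge joins the midpoints of the edges `x₁y₁`
and `x₂y₂`. -/
def F11Chord (x₁ y₁ x₂ y₂ : F11Vertex) :
    Graph (F11Vertex ⊕ Fin 2) (Sym2 F11Vertex ⊕ Fin 5) :=
  addChord F11 s(x₁, y₁) x₁ y₁ s(x₂, y₂) x₂ y₂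

/-- `H₁ = F₁₁ ∪ (AA' - 18)`. -/
def H1 : Graph (F11Vertex ⊕ Fin 2) (Sym2 F11Vertex ⊕ Fin 5) := F11Chord A A' n1 n8

/-- `H₂ = F₁₁ ∪ (A2 - 67)`. -/
def H2 : Graph (F11Vertex ⊕ Fin 2) (Sym2 F11Vertex ⊕ Fin 5) := F11Chord A n2 n6 n7

/-- `H₃ = F₁₁ ∪ (23 - 67)`. -/
def H3 : Graph (F11Vertex ⊕ Fin 2) (Sym2 F11Vertex ⊕ Fin 5) := F11Chord n2 n3 n6 n7

/-- `H₄ = F₁₁ ∪ (A2 - B'6)`. -/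
def H4 : Graph (F11Vertex ⊕ Fin 2) (Sym2 F11Vertex ⊕ Fin 5) := F11Chord A n2 B' n6

/-- Ten graphs of the form `F₁₁ ∪ e`. -/
def F11Cases : List (Graph (F11Vertex ⊕ Fin 2) (Sym2 F11Vertex ⊕ Fin 5)) :=
  [F11Chord A A' B B', F11Chord A A' B n3, F11Chord A A' n1 n2, F11Chord A A' n2 n3,
   F11Chord A A' n1 n8, F11Chord A n2 A' n7, F11Chord A n2 B n3, F11Chord A n2 B' n6,
   F11Chord A n2 n6 n7, F11Chord n2 n3 n6 n7]

end F11

end CubicTorus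

/-! Without the edges 23 and 67, F₁₁ falls into two copies of K₃,₃ minus an edge: one on A, 1, 7 |
A', 8, 2 lacking 27, one on B, 4, 6 | B', 5, 3 lacking 36. Exchanging the twins in A1, A'8, B4 or
B'5, the two sides, or the two copies generates sixty-four symmetries. Up to these, an edge is one
of three (`exists_symmetry_edge`) and a pair of distinct edges one of fourteen
(`exists_symmetry_edgePair`).

Girth: additions (i) and (ii) create cycles of length 1 and 2, and a chord between edges with a
common end closes a triangle. Four of the fourteen pairs have a common end; the other ten are the
listed ones.

Toroidality: a single drawing of F₁₁ on the 10 × 10 grid of the torus, where A'1, B'4 and 67 close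
up across the seams, leaves room for all additions that have to be drawn. New vertices are placed on
existing walks and the new edges are routed through a face. Of the ten disjoint pairs, four give H₁,
…, H₄ directly, and (A2, A'7) gives H₁ again by an isomorphism that is not a symmetry of F₁₁
(`F11Chord_isIsomorphic_H1`). By `toroidal_of_isGridDrawing`, a drawing is correct once the grid
cells it uses are pairwise distinct, which is a finite check. -/

namespace CubicTorus

/-! ### Drawings on the grid in the torus -/

/-- The index of the cell of the line, subdivided at the integers, that contains `x`: it is `2 * n`
for the vertex `n` and `2 * n + 1` for the open interval from `n` to `n + 1`. -/
noncomputable def cellIndex (x : ℝ) : ℤ := ⌊x⌋ + ⌈x⌉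

lemma cellIndex_intCast (n : ℤ) : cellIndex n = n + n := by
  simp [cellIndex]

lemma cellIndex_add_intCast (x : ℝ) (k : ℤ) : cellIndex (x + k) = cellIndex x + 2 * k := by
  simp only [cellIndex, Int.floor_add_intCast, Int.ceil_add_intCast]
  ring

/-- A step of length at most one leads from the vertex `a` through the cell `a + b` to `b`. -/
lemma cellIndex_between {a b : ℤ} (h : |b - a| ≤ 1) {θ : ℝ} (h0 : 0 < θ) (h1 : θ < 1) :
    cellIndex (a + θ * (b - a)) = a + b := by
  obtain ⟨d, rfl⟩ : ∃ d, b = a + d := ⟨b - a, by ring⟩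
  have hd : d = -1 ∨ d = 0 ∨ d = 1 := by
    rw [add_sub_cancel_left] at h
    have := abs_le.1 h
    omega
  rw [add_comm (a : ℝ), cellIndex_add_intCast]
  have hc : ⌈θ⌉ = 1 := by rw [Int.ceil_eq_iff]; norm_num; exact ⟨h0, h1.le⟩
  have hf : ⌊θ⌋ = 0 := by rw [Int.floor_eq_iff]; norm_num; exact ⟨h0.le, h1⟩
  have : cellIndex (θ * (((a + d : ℤ) : ℝ) - a)) = d := by
    rcases hd with rfl | rfl | rfl <;> simp [cellIndex, Int.floor_neg, Int.ceil_neg, hc, hf]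
  rw [this]
  ring

lemma coe_div_eq_coe_div_iff {N : ℕ} (hN : 0 < N) (x y : ℝ) :
    ((x / N : ℝ) : UnitAddCircle) = ((y / N : ℝ) : UnitAddCircle) ↔
      ∃ k : ℤ, x = y + ((k * N : ℤ) : ℝ) := by
  have hN' : (N : ℝ) ≠ 0 := by positivity
  rw [← sub_eq_zero, ← AddCircle.coe_sub, AddCircle.coe_eq_zero_iff]
  refine exists_congr fun k => ?_
  push_cast
  rw [zsmul_eq_mul, mul_one, ← sub_div, eq_div_iff hN']
  constructor <;> intro h <;> linarith

lemma cellIndex_emod_eq {N : ℕ} (hN : 0 < N) {x y : ℝ}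
    (h : ((x / N : ℝ) : UnitAddCircle) = ((y / N : ℝ) : UnitAddCircle)) :
    cellIndex x % (2 * N) = cellIndex y % (2 * N) := by
  obtain ⟨k, rfl⟩ := (coe_div_eq_coe_div_iff hN x y).1 h
  rw [cellIndex_add_intCast, show 2 * (k * (N : ℤ)) = 2 * N * k by ring, Int.add_mul_emod_self_left]

/-- The piecewise linear interpolation of the integers `a 0, …, a n` at `0, …, n`. -/
noncomputable def polyline (a : ℕ → ℤ) (n : ℕ) (t : ℝ) : ℝ :=
  a 0 + ∑ i ∈ Finset.range n, max 0 (min 1 (t - i)) * ((a (i + 1) : ℝ) - a i)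

@[fun_prop]
lemma continuous_polyline (a : ℕ → ℤ) (n : ℕ) : Continuous (polyline a n) := by
  unfold polyline
  fun_prop

/-- The summands before `i` are saturated at 1 and telescope to `a i - a 0`; those after `i` are
still 0. -/
lemma polyline_eq (a : ℕ → ℤ) {n i : ℕ} (hi : i < n) {t : ℝ} (h0 : (i : ℝ) ≤ t)
    (h1 : t ≤ i + 1) : polyline a n t = a i + (t - i) * ((a (i + 1) : ℝ) - a i) := by
  have hsum : ∑ j ∈ Finset.range n, max 0 (min 1 (t - j)) * ((a (j + 1) : ℝ) - a j) =
      ∑ j ∈ Finset.range (i + 1), max 0 (min 1 (t - j)) * ((a (j + 1) : ℝ) - a j) := by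
    refine (Finset.sum_subset (by simpa using hi) fun j _ hj => ?_).symm
    have hj : i + 1 ≤ j := by simpa using hj
    have hj : (i : ℝ) + 1 ≤ j := by exact_mod_cast hj
    rw [max_eq_left ((min_le_right _ _).trans (by linarith)), zero_mul]
  have hone : ∑ j ∈ Finset.range i, max 0 (min 1 (t - j)) * ((a (j + 1) : ℝ) - a j) =
      ∑ j ∈ Finset.range i, ((a (j + 1) : ℝ) - a j) := by
    refine Finset.sum_congr rfl fun j hj => ?_
    have hj : j + 1 ≤ i := Finset.mem_range.1 hj
    have hj : (j : ℝ) + 1 ≤ i := by exact_mod_cast hj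
    rw [min_eq_left (by linarith), max_eq_right zero_le_one, one_mul]
  rw [polyline, hsum, Finset.sum_range_succ, hone, Finset.sum_range_sub (fun j => (a j : ℝ)),
    min_eq_right (by linarith), max_eq_right (by linarith)]
  ring

lemma polyline_zero (a : ℕ → ℤ) {n : ℕ} (hn : 0 < n) : polyline a n 0 = a 0 := by
  rw [polyline_eq a hn (by simp) (by simp)]
  simp

lemma polyline_natCast_self (a : ℕ → ℤ) {n : ℕ} (hn : 0 < n) : polyline a n n = a n := by
  obtain ⟨m, rfl⟩ : ∃ m, n = m + 1 := ⟨n - 1, by omega⟩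
  rw [polyline_eq a (Nat.lt_succ_self m) (by simp) (by simp)]
  push_cast
  ring

/-- Strictly between consecutive integers the line stays in the cell between two consecutive values;
at an integer, floor and ceiling agree and give the index of a grid point. -/
lemma cellIndex_polyline {a : ℕ → ℤ} (ha : ∀ i, |a (i + 1) - a i| ≤ 1) {n : ℕ} {t : ℝ}
    (h0 : 0 ≤ t) (hn : t < n) : cellIndex (polyline a n t) = a ⌊t⌋₊ + a ⌈t⌉₊ := by
  have hi : ⌊t⌋₊ < n := (Nat.floor_lt h0).2 hn
  have hle : (⌊t⌋₊ : ℝ) ≤ t := Nat.floor_le h0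
  have hlt : t < ⌊t⌋₊ + 1 := Nat.lt_floor_add_one t
  rw [polyline_eq a hi hle hlt.le]
  rcases hle.eq_or_lt with h | h
  · have hc : ⌈t⌉₊ = ⌊t⌋₊ := by conv_lhs => rw [← h, Nat.ceil_natCast]
    rw [hc, show t - ⌊t⌋₊ = 0 by linarith, zero_mul, add_zero, cellIndex_intCast]
  · have hc : ⌈t⌉₊ = ⌊t⌋₊ + 1 := by
      rw [Nat.ceil_eq_iff (by omega)]
      exact ⟨by simpa using h, by exact_mod_cast hlt.le⟩
    rw [hc, cellIndex_between (ha _) (by linarith) (by linarith)]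

/-- The unit steps of the grid. -/
inductive Step
  | r | l | u | d

/-- The displacement of a unit step. -/
def Step.vec : Step → ℤ × ℤ
  | r => (1, 0)
  | l => (-1, 0)
  | u => (0, 1)
  | d => (0, -1)

/-- The point reached from `p` by the first `i` steps of `w`. -/
def walk (p : ℤ × ℤ) (w : List Step) (i : ℕ) : ℤ × ℤ :=
  p + ((w.take i).map Step.vec).sum

@[simp]
lemma walk_zero (p : ℤ × ℤ) (w : List Step) : walk p w 0 = p := by
  simp [walk]

lemma walk_succ (p : ℤ × ℤ) (w : List Step) {i : ℕ} (hi : i < w.length) :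
    walk p w (i + 1) = walk p w i + w[i].vec := by
  rw [walk, walk, List.take_add_one, List.getElem?_eq_getElem hi, Option.toList_some,
    List.map_append, List.sum_append, List.map_singleton, List.sum_singleton, add_assoc]

lemma walk_succ_of_le (p : ℤ × ℤ) (w : List Step) {i : ℕ} (hi : w.length ≤ i) :
    walk p w (i + 1) = walk p w i := by
  rw [walk, walk, List.take_of_length_le hi, List.take_of_length_le (by omega)]

lemma abs_walk_fst_le (p : ℤ × ℤ) (w : List Step) (i : ℕ) :
    |(walk p w (i + 1)).1 - (walk p w i).1| ≤ 1 := by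
  rcases lt_or_ge i w.length with hi | hi
  · rw [walk_succ p w hi]
    cases w[i] <;> simp [Step.vec]
  · simp [walk_succ_of_le p w hi]

lemma abs_walk_snd_le (p : ℤ × ℤ) (w : List Step) (i : ℕ) :
    |(walk p w (i + 1)).2 - (walk p w i).2| ≤ 1 := by
  rcases lt_or_ge i w.length with hi | hi
  · rw [walk_succ p w hi]
    cases w[i] <;> simp [Step.vec]
  · simp [walk_succ_of_le p w hi]

/-- The point of the torus, seen as a square of side `N` with opposite sides identified, that is
given by a pair of real coordinates. -/
noncomputable def torusPoint (N : ℕ) (x y : ℝ) : Torus :=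
  (((x / N : ℝ) : UnitAddCircle), ((y / N : ℝ) : UnitAddCircle))

/-- The cell of the `N × N` grid in the torus with the given pair of cell indices. -/
def torusCell (N : ℕ) (c : ℤ × ℤ) : ℤ × ℤ := (c.1 % (2 * N), c.2 % (2 * N))

/-- Used contrapositively: points in different cells are different, so disjointness of curves
reduces to integers. -/
lemma torusCell_eq_of_torusPoint_eq {N : ℕ} (hN : 0 < N) {x y x' y' : ℝ}
    (h : torusPoint N x y = torusPoint N x' y') :
    torusCell N (cellIndex x, cellIndex y) = torusCell N (cellIndex x', cellIndex y') :=
  Prod.ext (cellIndex_emod_eq hN (congrArg Prod.fst h))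
    (cellIndex_emod_eq hN (congrArg Prod.snd h))

/-- The point of the torus at the grid point `p`. -/
noncomputable def gridPoint (N : ℕ) (p : ℤ × ℤ) : Torus := torusPoint N p.1 p.2

lemma gridPoint_eq {N : ℕ} (hN : 0 < N) {p q : ℤ × ℤ}
    (h : torusCell N (p + p) = torusCell N (q + q)) : gridPoint N p = gridPoint N q := by
  have key : ∀ a b : ℤ, (a + a) % (2 * N) = (b + b) % (2 * N) →
      (((a : ℝ) / N : ℝ) : UnitAddCircle) = (((b : ℝ) / N : ℝ) : UnitAddCircle) := by
    intro a b hab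
    -- Grid points have even cell indices, so the congruence modulo `2 * N` halves to one modulo
    -- `N`.
    rw [← two_mul, ← two_mul, Int.mul_emod_mul_of_pos _ _ two_pos,
      Int.mul_emod_mul_of_pos _ _ two_pos] at hab
    obtain ⟨k, hk⟩ := Int.dvd_of_emod_eq_zero
      (Int.emod_eq_emod_iff_emod_sub_eq_zero.1 (mul_left_cancel₀ two_ne_zero hab))
    exact (coe_div_eq_coe_div_iff hN _ _).2 ⟨k, by
      rw [← Int.cast_add]; congr 1; linarith⟩
  exact Prod.ext (key _ _ (congrArg Prod.fst h)) (key _ _ (congrArg Prod.snd h))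

/-- The curve in the torus that runs at constant speed along the walk `w` from `p`. -/
noncomputable def walkCurve (N : ℕ) (p : ℤ × ℤ) (w : List Step) : C(unitInterval, Torus) where
  toFun t := torusPoint N
    (polyline (fun i => (walk p w i).1) w.length (w.length * t))
    (polyline (fun i => (walk p w i).2) w.length (w.length * t))
  continuous_toFun := by
    unfold torusPoint
    exact ((AddCircle.continuous_mk' _).comp (by fun_prop)).prodMk
      ((AddCircle.continuous_mk' _).comp (by fun_prop))

/-- The cells that the walk `w` from `p` traverses between its ends. -/
def innerCells (N : ℕ) (p : ℤ × ℤ) (w : List Step) : List (ℤ × ℤ) :=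
  (List.range (2 * w.length - 1)).map fun m =>
    torusCell N (walk p w ((m + 1) / 2) + walk p w ((m + 2) / 2))

/-- The sum of floor and ceiling numbers the cells met along a walk. As the two differ by at most
one, halving the sum recovers both. -/
lemma floor_ceil_of_add (t : ℝ) :
    (⌊t⌋₊ + ⌈t⌉₊) / 2 = ⌊t⌋₊ ∧ (⌊t⌋₊ + ⌈t⌉₊ + 1) / 2 = ⌈t⌉₊ := by
  have h1 := Nat.floor_le_ceil t
  have h2 := Nat.ceil_le_floor_add_one t
  omega

lemma walkCurve_parameter {w : List Step} (hw : w ≠ []) {t : unitInterval}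
    (ht : t ∈ Set.Ioo 0 1) : 0 < w.length * (t : ℝ) ∧ w.length * (t : ℝ) < w.length := by
  have hn : (0 : ℝ) < w.length := by exact_mod_cast List.length_pos_iff.2 hw
  exact ⟨mul_pos hn ht.1, mul_lt_of_lt_one_right hn ht.2⟩

lemma torusCell_walkCurve {N : ℕ} {p : ℤ × ℤ} {w : List Step} {t : ℝ} (h0 : 0 ≤ t)
    (h1 : t < w.length) :
    torusCell N (cellIndex (polyline (fun i => (walk p w i).1) w.length t),
      cellIndex (polyline (fun i => (walk p w i).2) w.length t)) =
    torusCell N (walk p w ⌊t⌋₊ + walk p w ⌈t⌉₊) := by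
  have hx := cellIndex_polyline (a := fun i => (walk p w i).1) (abs_walk_fst_le p w) h0 h1
  have hy := cellIndex_polyline (a := fun i => (walk p w i).2) (abs_walk_snd_le p w) h0 h1
  rw [hx, hy]
  rfl

lemma exists_cell_of_walkCurve (N : ℕ) (p : ℤ × ℤ) {w : List Step} (hw : w ≠ [])
    {t : unitInterval} (ht : t ∈ Set.Ioo 0 1) :
    ∃ x y, walkCurve N p w t = torusPoint N x y ∧
      torusCell N (cellIndex x, cellIndex y) ∈ innerCells N p w := by
  obtain ⟨h0, h1⟩ := walkCurve_parameter hw ht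
  refine ⟨_, _, rfl, ?_⟩
  rw [torusCell_walkCurve h0.le h1]
  have hc : 1 ≤ ⌈(w.length * t : ℝ)⌉₊ := Nat.one_le_iff_ne_zero.2 (Nat.ceil_pos.2 h0).ne'
  have hf : ⌊(w.length * t : ℝ)⌋₊ < w.length := (Nat.floor_lt h0.le).2 h1
  have h2 := Nat.ceil_le_floor_add_one (w.length * t : ℝ)
  obtain ⟨h3, h4⟩ := floor_ceil_of_add (w.length * t : ℝ)
  refine List.mem_map.2 ⟨⌊(w.length * t : ℝ)⌋₊ + ⌈(w.length * t : ℝ)⌉₊ - 1, ?_, ?_⟩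
  · rw [List.mem_range]
    omega
  · congr 3 <;> omega

/-- Distinctness of the cells forces equal points into the same unit segment of the walk. There one
coordinate moves with slope ±1, which determines the parameter. -/
lemma injOn_walkCurve {N : ℕ} (hN : 0 < N) (p : ℤ × ℤ) {w : List Step} (hw : w ≠ [])
    (hnd : (innerCells N p w).Nodup) : Set.InjOn (walkCurve N p w) (Set.Ioo 0 1) := by
  intro s hs t ht hst
  obtain ⟨hs0, hs1⟩ := walkCurve_parameter hw hs
  obtain ⟨ht0, ht1⟩ := walkCurve_parameter hw ht
  suffices h : (w.length * s : ℝ) = w.length * t by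
    have hn : (w.length : ℝ) ≠ 0 := by exact_mod_cast (List.length_pos_iff.2 hw).ne'
    exact Subtype.ext (mul_left_cancel₀ hn h)
  change torusPoint N _ _ = torusPoint N _ _ at hst
  generalize (w.length * s : ℝ) = S at *
  generalize (w.length * t : ℝ) = T at *
  have hcell := torusCell_eq_of_torusPoint_eq hN hst
  rw [torusCell_walkCurve hs0.le hs1, torusCell_walkCurve ht0.le ht1] at hcell
  have hcs : 0 < ⌈S⌉₊ := Nat.ceil_pos.2 hs0
  have hct : 0 < ⌈T⌉₊ := Nat.ceil_pos.2 ht0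
  have hfs : ⌊S⌋₊ < w.length := (Nat.floor_lt hs0.le).2 hs1
  have hft : ⌊T⌋₊ < w.length := (Nat.floor_lt ht0.le).2 ht1
  have hs2 := Nat.ceil_le_floor_add_one S
  have ht2 := Nat.ceil_le_floor_add_one T
  obtain ⟨hs3, hs4⟩ := floor_ceil_of_add S
  obtain ⟨ht3, ht4⟩ := floor_ceil_of_add T
  -- The list of inner cells omits the starting point, cell number 0; hence the shift by one.
  have hidx : ⌊S⌋₊ + ⌈S⌉₊ - 1 = ⌊T⌋₊ + ⌈T⌉₊ - 1 := by
    refine List.inj_on_of_nodup_map hnd (List.mem_range.2 (by omega))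
      (List.mem_range.2 (by omega)) ?_
    rw [show (⌊S⌋₊ + ⌈S⌉₊ - 1 + 1) / 2 = ⌊S⌋₊ by omega,
      show (⌊S⌋₊ + ⌈S⌉₊ - 1 + 2) / 2 = ⌈S⌉₊ by omega,
      show (⌊T⌋₊ + ⌈T⌉₊ - 1 + 1) / 2 = ⌊T⌋₊ by omega,
      show (⌊T⌋₊ + ⌈T⌉₊ - 1 + 2) / 2 = ⌈T⌉₊ by omega]
    exact hcell
  have hfl : ⌊S⌋₊ = ⌊T⌋₊ := by omega
  have hSle := Nat.floor_le hs0.le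
  have hTle := Nat.floor_le ht0.le
  have hSlt := Nat.lt_floor_add_one S
  have hTlt := Nat.lt_floor_add_one T
  rw [hfl] at hSle hSlt
  generalize ⌊T⌋₊ = i at *
  have key : ∀ a : ℕ → ℤ, (((polyline a w.length S) / N : ℝ) : UnitAddCircle) =
      (((polyline a w.length T) / N : ℝ) : UnitAddCircle) → |a (i + 1) - a i| = 1 → S = T := by
    intro a ha hstep
    rw [polyline_eq a hft hSle hSlt.le, polyline_eq a hft hTle hTlt.le,
      coe_div_eq_coe_div_iff hN] at ha
    obtain ⟨k, hk⟩ := ha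
    have hk' : (S - T) * ((a (i + 1) - a i : ℤ) : ℝ) = k * N := by
      push_cast at hk ⊢
      linarith
    have habs : |S - T| = |(k : ℝ)| * N := by
      have := congrArg abs hk'
      rwa [abs_mul, abs_mul, ← Int.cast_abs, hstep, Int.cast_one, mul_one, Nat.abs_cast] at this
    -- Both parameters lie in the same half-open unit interval, while a nonzero multiple of `N` has
    -- absolute value at least 1.
    have hlt : |S - T| < 1 := abs_lt.2 ⟨by linarith, by linarith⟩
    have hN1 : (1 : ℝ) ≤ N := by exact_mod_cast hN
    have hk0 : k = 0 := by
      by_contra hne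
      have h1 : (1 : ℝ) ≤ |(k : ℝ)| := by exact_mod_cast Int.one_le_abs hne
      nlinarith
    rw [hk0, Int.cast_zero, abs_zero, zero_mul, abs_eq_zero] at habs
    linarith
  have hw1 := walk_succ p w hft
  have hstep : |(walk p w (i + 1)).1 - (walk p w i).1| = 1 ∨
      |(walk p w (i + 1)).2 - (walk p w i).2| = 1 := by
    rw [hw1]
    cases w[i] <;> simp [Step.vec]
  rcases hstep with h | h
  · exact key _ (congrArg Prod.fst hst) h
  · exact key _ (congrArg Prod.snd hst) h

/-- An edge of a graph drawn as a walk in the grid. -/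
structure Route (α β : Type*) where
  /-- the edge -/
  edge : β
  /-- its first end -/
  src : α
  /-- its second end -/
  tgt : α
  /-- the steps from the first end to the second -/
  steps : List Step

/-- The vertices `vs`, at the grid points `p`, and the edges, drawn along the routes `R`, use
pairwise distinct cells of the `N × N` grid in the torus, and every route ends where it should. -/
def IsGridDrawing {α β : Type*} (N : ℕ) (p : α → ℤ × ℤ) (vs : List α) (R : List (Route α β)) :
    Prop :=
  (∀ r ∈ R, r.steps.length ≠ 0 ∧
    torusCell N (walk (p r.src) r.steps r.steps.length + walk (p r.src) r.steps r.steps.length) =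
      torusCell N (p r.tgt + p r.tgt)) ∧
  (vs.map (fun x => torusCell N (p x + p x)) ++
    R.flatMap (fun r => innerCells N (p r.src) r.steps)).Nodup

instance {α β : Type*} (N : ℕ) (p : α → ℤ × ℤ) (vs : List α) (R : List (Route α β)) :
    Decidable (IsGridDrawing N p vs R) :=
  inferInstanceAs (Decidable (_ ∧ _))

/-- Except for the injectivity of a single curve, each separation condition of an embedding says
that two points lie in different cells. The list may contain routes of non-edges. -/
theorem toroidal_of_isGridDrawing {α β : Type*} {G : Graph α β} {N : ℕ} (hN : 0 < N)
    {p : α → ℤ × ℤ} {vs : List α} {R : List (Route α β)} (hV : ∀ x ∈ V(G), x ∈ vs)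
    (hE : ∀ e ∈ E(G), ∃ r ∈ R, r.edge = e ∧ G.IsLink e r.src r.tgt)
    (h : IsGridDrawing N p vs R) : Toroidal G := by
  obtain ⟨hR, hnd⟩ := h
  obtain ⟨hvs, hinner, hdisj⟩ := List.nodup_append'.1 hnd
  obtain ⟨hroute, hpair⟩ := List.nodup_flatMap.1 hinner
  choose ρ hρR hρe hρlink using fun e : E(G) => hE e e.2
  have hne : ∀ e, (ρ e).steps ≠ [] := fun e =>
    List.length_pos_iff.1 (Nat.pos_of_ne_zero (hR _ (hρR e)).1)
  refine ⟨⟨fun x => gridPoint N (p x), fun e => walkCurve N (p (ρ e).src) (ρ e).steps,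
    fun x y hxy => ?_, fun e => ?_, fun e => ?_, fun e t ht x => ?_,
    fun e e' hee s hs t ht hst => ?_⟩⟩
  · have := torusCell_eq_of_torusPoint_eq hN hxy
    rw [cellIndex_intCast, cellIndex_intCast, cellIndex_intCast, cellIndex_intCast] at this
    exact Subtype.ext (List.inj_on_of_nodup_map hvs (hV x x.2) (hV y y.2) this)
  · have hlink := hρlink e
    have hlen := List.length_pos_iff.2 (hne e)
    refine ⟨⟨_, hlink.left_mem⟩, ⟨_, hlink.right_mem⟩, hlink, ?_, ?_⟩
    · simp [walkCurve, gridPoint, polyline_zero _ hlen]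
    · rw [← gridPoint_eq hN (hR _ (hρR e)).2]
      simp [walkCurve, gridPoint, polyline_natCast_self _ hlen]
  · exact injOn_walkCurve hN _ (hne e) (hroute _ (hρR e))
  · intro hx
    obtain ⟨a, b, hab, hmem⟩ := exists_cell_of_walkCurve N (p (ρ e).src) (hne e) ht
    have := torusCell_eq_of_torusPoint_eq hN (hab.symm.trans hx)
    rw [cellIndex_intCast, cellIndex_intCast] at this
    rw [this] at hmem
    exact hdisj (List.mem_map.2 ⟨x, hV x x.2, rfl⟩) (List.mem_flatMap.2 ⟨_, hρR e, hmem⟩)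
  · obtain ⟨a, b, hab, hmem⟩ := exists_cell_of_walkCurve N (p (ρ e).src) (hne e) hs
    obtain ⟨a', b', hab', hmem'⟩ := exists_cell_of_walkCurve N (p (ρ e').src) (hne e') ht
    have := torusCell_eq_of_torusPoint_eq hN (hab.symm.trans (hst.trans hab'))
    rw [this] at hmem
    have : Std.Symm (Function.onFun List.Disjoint fun r : Route α β =>
        innerCells N (p r.src) r.steps) := ⟨fun _ _ h => h.symm⟩
    -- Different edges have different routes, because a route records its edge.
    refine hpair.forall (hρR e) (hρR e') (fun heq => hee ?_) hmem hmem'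
    exact Subtype.ext ((hρe e).symm.trans ((congrArg Route.edge heq).trans (hρe e')))

/-! ### Isomorphisms, cycles and girth -/

section Isomorphism

variable {α β α' β' α'' β'' : Type*} {G : Graph α β} {H : Graph α' β'} {K : Graph α'' β''}

lemma IsIsomorphic.trans (h : IsIsomorphic G H) (h' : IsIsomorphic H K) : IsIsomorphic G K := by
  obtain ⟨φ, ψ, h⟩ := h
  obtain ⟨φ', ψ', h'⟩ := h'
  exact ⟨φ.trans φ', ψ.trans ψ', fun e x y => by simp [h, h']⟩

lemma isIsomorphic_of_equiv (a : α ≃ α') (b : β ≃ β') (hV : ∀ x, x ∈ V(G) ↔ a x ∈ V(H))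
    (h : ∀ e x y, G.IsLink e x y ↔ H.IsLink (b e) (a x) (a y)) : IsIsomorphic G H := by
  refine ⟨a.subtypeEquiv hV, b.subtypeEquiv fun e => ?_, fun e x y => h e x y⟩
  rw [G.edge_mem_iff_exists_isLink, H.edge_mem_iff_exists_isLink]
  constructor
  · rintro ⟨x, y, hxy⟩
    exact ⟨_, _, (h e x y).1 hxy⟩
  · rintro ⟨x, y, hxy⟩
    exact ⟨a.symm x, a.symm y, (h e _ _).2 (by simpa using hxy)⟩

/-- For graphs without parallel edges, a bijection of the vertices that preserves adjacency is an
isomorphism. -/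
lemma isIsomorphic_of_adj (hG : ∀ e e' x y, G.IsLink e x y → G.IsLink e' x y → e = e')
    (hH : ∀ e e' x y, H.IsLink e x y → H.IsLink e' x y → e = e') (a : α ≃ α')
    (hV : ∀ x, x ∈ V(G) ↔ a x ∈ V(H)) (h : ∀ x y, G.Adj x y ↔ H.Adj (a x) (a y)) :
    IsIsomorphic G H := by
  have key : ∀ e : E(G), ∃ e' : E(H), ∀ x y, G.IsLink e x y ↔ H.IsLink e' (a x) (a y) := by
    intro e
    obtain ⟨x, y, hxy⟩ := G.exists_isLink_of_mem_edgeSet e.2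
    obtain ⟨e', he'⟩ := (h x y).1 ⟨_, hxy⟩
    refine ⟨⟨e', he'.edge_mem⟩, fun z w => ⟨fun hzw => ?_, fun hzw => ?_⟩⟩
    · rcases hxy.eq_and_eq_or_eq_and_eq hzw with ⟨rfl, rfl⟩ | ⟨rfl, rfl⟩
      exacts [he', he'.symm]
    · rcases he'.eq_and_eq_or_eq_and_eq hzw with ⟨h1, h2⟩ | ⟨h1, h2⟩ <;>
        obtain rfl := a.injective h1 <;> obtain rfl := a.injective h2
      exacts [hxy, hxy.symm]
  obtain ⟨ψ, hψ⟩ := Classical.skolem.1 key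
  refine ⟨a.subtypeEquiv hV, Equiv.ofBijective ψ ⟨fun e e' hee => ?_, fun e' => ?_⟩,
    fun e x y => hψ e x y⟩
  · obtain ⟨x, y, hxy⟩ := G.exists_isLink_of_mem_edgeSet e.2
    exact Subtype.ext (hG _ _ x y hxy ((hψ e' x y).2 (hee ▸ (hψ e x y).1 hxy)))
  · obtain ⟨x, y, hxy⟩ := H.exists_isLink_of_mem_edgeSet e'.2
    obtain ⟨e, he⟩ := (h (a.symm x) (a.symm y)).2 ⟨_, by simpa using hxy⟩
    refine ⟨⟨e, he.edge_mem⟩, Subtype.ext (hH _ _ x y ?_ hxy)⟩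
    simpa using (hψ ⟨e, he.edge_mem⟩ _ _).1 he

lemma Toroidal.of_isIsomorphic (h : IsIsomorphic G H) (hH : Toroidal H) : Toroidal G := by
  obtain ⟨φ, ψ, h⟩ := h
  obtain ⟨D⟩ := hH
  refine ⟨⟨fun x => D.point (φ x), fun e => D.curve (ψ e), D.point_injective.comp φ.injective,
    fun e => ?_, fun e => D.curve_injOn _, fun e t ht x => D.curve_ne_point _ t ht _,
    fun e e' hee => D.curve_ne_curve _ _ (ψ.injective.ne hee)⟩⟩
  obtain ⟨x, y, hxy, hx, hy⟩ := D.curve_ends (ψ e)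
  exact ⟨φ.symm x, φ.symm y, (h _ _ _).2 (by simpa using hxy), by simpa using hx, by simpa using hy⟩

lemma HasCycle.of_isIsomorphic {n : ℕ} (h : IsIsomorphic G H) (hH : HasCycle H n) :
    HasCycle G n := by
  obtain ⟨φ, ψ, h⟩ := h
  obtain ⟨v, ε, hv, hε, hlink⟩ := hH
  refine ⟨fun i => φ.symm ⟨v i, (hlink i).left_mem⟩, fun i => ψ.symm ⟨ε i, (hlink i).edge_mem⟩,
    fun i j hij => hv ?_, fun i j hij => hε ?_, fun i => (h _ _ _).2 ?_⟩
  · simpa using φ.symm.injective (Subtype.ext hij)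
  · simpa using ψ.symm.injective (Subtype.ext hij)
  · simpa using hlink i

lemma girth_lt_four {n : ℕ} (hn : 1 ≤ n) (hn4 : n < 4) (h : HasCycle G n) : ¬ 4 ≤ girth G := by
  have h1 : girth G ≤ n := iInf₂_le n ⟨hn, h⟩
  exact not_le.2 (h1.trans_lt (by exact_mod_cast hn4))

end Isomorphism

/-! ### Isomorphisms and short cycles of edge additions -/

section Rebuild

variable {α β α' β' κ κ' : Type*} {G : Graph α β} {G' : Graph α' β'}

/-- This serves both relabellings of the new vertices and edges (with `a`, `b` the identity) and
symmetries of the old graph (with `c`, `π` the identity). -/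
lemma rebuild_isIsomorphic {F : Set β} {F' : Set β'} {f : κ → Sym2 (α ⊕ Fin 2)}
    {f' : κ' → Sym2 (α' ⊕ Fin 2)} (a : α ≃ α') (b : β ≃ β') (c : Fin 2 ≃ Fin 2) (π : κ ≃ κ')
    (hV : ∀ x, x ∈ V(G) ↔ a x ∈ V(G'))
    (hG : ∀ e x y, G.IsLink e x y ↔ G'.IsLink (b e) (a x) (a y))
    (hF : ∀ e, e ∈ F ↔ b e ∈ F') (hf : ∀ k, f' (π k) = (f k).map (a.sumCongr c)) :
    IsIsomorphic (rebuild G F f) (rebuild G' F' f') := by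
  refine isIsomorphic_of_equiv (a.sumCongr c) (b.sumCongr π) (fun p => ?_) ?_
  · change (p ∈ Sum.inl '' V(G) ∪ Set.range Sum.inr ∪ {p | ∃ k, p ∈ f k}) ↔
      (a.sumCongr c p ∈ Sum.inl '' V(G') ∪ Set.range Sum.inr ∪ {p | ∃ k, p ∈ f' k})
    have h : (∃ k, p ∈ f k) ↔ ∃ k, a.sumCongr c p ∈ f' k := by
      rw [← π.exists_congr_right]
      refine exists_congr fun k => ?_
      rw [hf, Sym2.mem_map]
      simp only [EmbeddingLike.apply_eq_iff_eq, exists_eq_right]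
    rw [Set.mem_union, Set.mem_union, Set.mem_union, Set.mem_union, Set.mem_ofPred_eq,
      Set.mem_ofPred_eq, h]
    rcases p with x | i
    · simp [hV]
    · simp
  · rintro (e | k) p q
    · change (e ∉ F ∧ ∃ x y, G.IsLink e x y ∧ p = Sum.inl x ∧ q = Sum.inl y) ↔
        (b e ∉ F' ∧ ∃ x y, G'.IsLink (b e) x y ∧ a.sumCongr c p = Sum.inl x ∧
          a.sumCongr c q = Sum.inl y)
      rw [hF]
      rcases p with x | i <;> rcases q with y | j <;> simp [hG]
    · change f k = s(p, q) ↔ f' (π k) = s(a.sumCongr c p, a.sumCongr c q)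
      rw [hf, ← Sym2.map_mk, (Sym2.map.injective (a.sumCongr c).injective).eq_iff]

variable (G)

lemma addLoop_swap (e : β) (x y : α) : IsIsomorphic (addLoop G e x y) (addLoop G e y x) := by
  refine rebuild_isIsomorphic (.refl _) (.refl _) (.refl _) (Equiv.swap 0 1) (by simp) (by simp)
    (by simp) fun k => ?_
  fin_cases k <;> first | rfl | exact Sym2.eq_swap

lemma addParallel_swap (e : β) (x y : α) :
    IsIsomorphic (addParallel G e x y) (addParallel G e y x) := by
  refine rebuild_isIsomorphic (.refl _) (.refl _) (Equiv.swap 0 1) (Equiv.swap 0 2) (by simp)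
    (by simp) (by simp) fun k => ?_
  fin_cases k <;> first | rfl | exact Sym2.eq_swap

lemma addChord_swap_left (e₁ : β) (x₁ y₁ : α) (e₂ : β) (x₂ y₂ : α) :
    IsIsomorphic (addChord G e₁ x₁ y₁ e₂ x₂ y₂) (addChord G e₁ y₁ x₁ e₂ x₂ y₂) := by
  refine rebuild_isIsomorphic (.refl _) (.refl _) (.refl _) (Equiv.swap 0 1) (by simp) (by simp)
    (by simp) fun k => ?_
  fin_cases k <;> first | rfl | exact Sym2.eq_swap

lemma addChord_comm (e₁ : β) (x₁ y₁ : α) (e₂ : β) (x₂ y₂ : α) :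
    IsIsomorphic (addChord G e₁ x₁ y₁ e₂ x₂ y₂) (addChord G e₂ x₂ y₂ e₁ x₁ y₁) := by
  -- The halves 0, 1 of the first edge are exchanged with the halves 2, 3 of the second; the chord 4
  -- stays.
  refine rebuild_isIsomorphic (.refl _) (.refl _) (Equiv.swap 0 1)
    (Equiv.swap 0 2 * Equiv.swap 1 3) (by simp) (by simp) (by simp [or_comm]) fun k => ?_
  fin_cases k <;> first | rfl | exact Sym2.eq_swap

lemma hasCycle_addLoop (e : β) (x y : α) : HasCycle (addLoop G e x y) 1 :=
  ⟨fun _ => Sum.inr 1, fun _ => Sum.inr 3, Function.injective_of_subsingleton _,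
    Function.injective_of_subsingleton _, fun _ => rfl⟩

lemma hasCycle_addParallel (e : β) (x y : α) : HasCycle (addParallel G e x y) 2 := by
  -- Edges 1 and 3 are the two parallel edges `uv`.
  refine ⟨fun i => Sum.inr i, fun i => Sum.inr ((![1, 3] : Fin 2 → Fin 4) i),
    Sum.inr_injective, Sum.inr_injective.comp
      (show Function.Injective (![1, 3] : Fin 2 → Fin 4) by decide), fun i => ?_⟩
  match i with
  | 0 => rfl
  | 1 => exact Sym2.eq_swap

lemma hasCycle_addChord (e₁ : β) (x y₁ : α) (e₂ : β) (y₂ : α) :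
    HasCycle (addChord G e₁ x y₁ e₂ x y₂) 3 := by
  -- The triangle `x`, `u`, `v`: edges 0 and 2 are the halves at the common end `x`, edge 4 is the
  -- chord.
  refine ⟨fun i => (![Sum.inl x, Sum.inr 0, Sum.inr 1] : Fin 3 → α ⊕ Fin 2) i,
    fun i => Sum.inr ((![0, 4, 2] : Fin 3 → Fin 5) i), fun i j => ?_,
    Sum.inr_injective.comp (show Function.Injective (![0, 4, 2] : Fin 3 → Fin 5) by decide),
    fun i => ?_⟩
  · match i, j with
    | 0, 0 | 1, 1 | 2, 2 => simp
    | 0, 1 | 0, 2 | 1, 0 | 2, 0 | 1, 2 | 2, 1 => simp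
  · match i with
    | 0 => rfl
    | 1 => rfl
    | 2 => exact Sym2.eq_swap

end Rebuild

/-! ### The symmetries of `F₁₁` -/

open F11Vertex

lemma F11_isLink_iff {e : Sym2 F11Vertex} {x y : F11Vertex} :
    F11.IsLink e x y ↔ e = s(x, y) ∧ s(x, y) ∈ F11Edges := by
  -- `SimpleGraph.fromEdgeSet` discards diagonal pairs, so their absence has to be checked.
  have hdiag : ∀ z ∈ F11Edges, ¬ z.IsDiag := by decide
  change (e = s(x, y) ∧ e ∈ (SimpleGraph.fromEdgeSet (F11Edges : Set (Sym2 F11Vertex))).edgeSet) ↔ _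
  rw [SimpleGraph.edgeSet_fromEdgeSet]
  constructor
  · rintro ⟨rfl, h⟩
    exact ⟨rfl, h.1⟩
  · rintro ⟨rfl, h⟩
    exact ⟨rfl, h, hdiag _ h⟩

/-- The symmetry that exchanges `A` and `1`. -/
def swapA : F11Vertex → F11Vertex
  | A => n1 | n1 => A | x => x

/-- The symmetry that exchanges `A'` and `8`. -/
def swapA' : F11Vertex → F11Vertex
  | A' => n8 | n8 => A' | x => x

/-- The symmetry that exchanges `B` and `4`. -/
def swapB : F11Vertex → F11Vertex
  | B => n4 | n4 => B | x => x

/-- The symmetry that exchanges `B'` and `5`. -/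
def swapB' : F11Vertex → F11Vertex
  | B' => n5 | n5 => B' | x => x

/-- The symmetry that exchanges the edges `23` and `67`. -/
def swapSides : F11Vertex → F11Vertex
  | A => A' | A' => A | B => B' | B' => B | n1 => n8 | n2 => n7 | n3 => n6 | n4 => n5
  | n5 => n4 | n6 => n3 | n7 => n2 | n8 => n1

/-- The symmetry that exchanges the two components of `F₁₁` without the edges `23` and `67`. -/
def swapParts : F11Vertex → F11Vertex
  | A => B | A' => B' | B => A | B' => A' | n1 => n4 | n2 => n3 | n3 => n2 | n4 => n1
  | n5 => n8 | n6 => n7 | n7 => n6 | n8 => n5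

/-- The map `g` is an automorphism of `F₁₁`. -/
def IsSymmetry (g : F11Vertex → F11Vertex) : Prop :=
  Function.Bijective g ∧ ∀ x y, s(g x, g y) ∈ F11Edges ↔ s(x, y) ∈ F11Edges

lemma IsSymmetry.comp {g h : F11Vertex → F11Vertex} (hg : IsSymmetry g) (hh : IsSymmetry h) :
    IsSymmetry (g ∘ h) :=
  ⟨hg.1.comp hh.1, fun x y => (hg.2 _ _).trans (hh.2 x y)⟩

/-- For an involution, preserving edges also reflects them: apply it twice. -/
lemma isSymmetry_of_involutive {g : F11Vertex → F11Vertex} (hg : ∀ x, g (g x) = x)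
    (h : ∀ z ∈ F11Edges, z.map g ∈ F11Edges) : IsSymmetry g := by
  refine ⟨Function.Involutive.bijective hg, fun x y => ⟨fun hxy => ?_, h s(x, y)⟩⟩
  simpa [hg] using h _ hxy

/-- Apply `g` unless `b` is true. -/
def applyUnless (g : F11Vertex → F11Vertex) (b : Bool) (x : F11Vertex) : F11Vertex :=
  bif b then x else g x

lemma IsSymmetry.applyUnless {g : F11Vertex → F11Vertex} (hg : IsSymmetry g) (b : Bool) :
    IsSymmetry (applyUnless g b) := by
  cases b
  exacts [hg, ⟨Function.bijective_id, fun _ _ => Iff.rfl⟩]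

/-- The sixty-four symmetries of `F₁₁`. -/
def symmetry (a b c d e f : Bool) (x : F11Vertex) : F11Vertex :=
  applyUnless swapA a (applyUnless swapA' b (applyUnless swapB c (applyUnless swapB' d
    (applyUnless swapSides e (applyUnless swapParts f x)))))

lemma isSymmetry_symmetry (a b c d e f : Bool) : IsSymmetry (symmetry a b c d e f) := by
  have h1 : IsSymmetry swapA := isSymmetry_of_involutive (by decide) (by decide +kernel)
  have h2 : IsSymmetry swapA' := isSymmetry_of_involutive (by decide) (by decide +kernel)
  have h3 : IsSymmetry swapB := isSymmetry_of_involutive (by decide) (by decide +kernel)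
  have h4 : IsSymmetry swapB' := isSymmetry_of_involutive (by decide) (by decide +kernel)
  have h5 : IsSymmetry swapSides := isSymmetry_of_involutive (by decide) (by decide +kernel)
  have h6 : IsSymmetry swapParts := isSymmetry_of_involutive (by decide) (by decide +kernel)
  exact (h1.applyUnless a).comp ((h2.applyUnless b).comp ((h3.applyUnless c).comp
    ((h4.applyUnless d).comp ((h5.applyUnless e).comp (h6.applyUnless f)))))

lemma exists_symmetry_edge : ∀ z ∈ F11Edges, ∃ f e d c b a,
    z.map (symmetry a b c d e f) ∈ [s(B', n4), s(n7, A'), s(n7, n6)] := by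
  decide +kernel

lemma exists_symmetry_first : ∀ z ∈ F11Edges, ∃ f e d c b a,
    z.map (symmetry a b c d e f) ∈ [s(A, A'), s(A, n2), s(n2, n3)] := by
  decide +kernel

/-- Representatives of the pairs of distinct edges up to symmetry. -/
def edgePairs : List (F11Vertex × F11Vertex × F11Vertex × F11Vertex) :=
  [(A, A', B, B'), (A, A', B, n3), (A, A', n1, n2), (A, A', n2, n3), (A, A', n1, n8),
   (A, n2, A', n7), (A, n2, B, n3), (A, n2, B', n6), (A, n2, n6, n7), (n2, n3, n6, n7),
   (A, A', A, n8), (A, A', A, n2), (n7, A', n7, n8), (n7, A', n7, n6)]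

/-- With the first edge already normalised, only 3 · 17 pairs remain to be searched. The symmetry
found here may move that edge again and may exchange the two edges. -/
lemma exists_symmetry_second : ∀ z ∈ [s(A, A'), s(A, n2), s(n2, n3)], ∀ z' ∈ F11Edges, z ≠ z' →
    ∃ f e d c b a, ∃ r ∈ edgePairs,
      s(z.map (symmetry a b c d e f), z'.map (symmetry a b c d e f)) =
        s(s(r.1, r.2.1), s(r.2.2.1, r.2.2.2)) := by
  decide +kernel

/-- Every pair of distinct edges can be moved to one of the representatives. -/
lemma exists_symmetry_edgePair {z z' : Sym2 F11Vertex} (hz : z ∈ F11Edges) (hz' : z' ∈ F11Edges)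
    (hne : z ≠ z') : ∃ g, IsSymmetry g ∧ ∃ r ∈ edgePairs,
      s(z.map g, z'.map g) = s(s(r.1, r.2.1), s(r.2.2.1, r.2.2.2)) := by
  obtain ⟨f, e, d, c, b, a, hg⟩ := exists_symmetry_first z hz
  have hsymm := isSymmetry_symmetry a b c d e f
  have hmem : z'.map (symmetry a b c d e f) ∈ F11Edges := by
    induction z' with | h x y => exact (hsymm.2 x y).2 hz'
  obtain ⟨f', e', d', c', b', a', r, hr, h⟩ := exists_symmetry_second _ hg _ hmem
    ((Sym2.map.injective hsymm.1.injective).ne hne)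
  refine ⟨_, (isSymmetry_symmetry a' b' c' d' e' f').comp hsymm, r, hr, ?_⟩
  rw [← h, Sym2.map_map, Sym2.map_map]

/-! ### Transport of edge additions along symmetries -/

section Transfer

variable {g : F11Vertex → F11Vertex}

/-- Edges of F₁₁ are labelled by their pairs of ends, so `g` induces the bijection `Sym2.map g` of
the labels. -/
lemma rebuild_isIsomorphic_of_isSymmetry (hg : IsSymmetry g) {κ : Type*}
    {F F' : Set (Sym2 F11Vertex)}
    {f f' : κ → Sym2 (F11Vertex ⊕ Fin 2)} (hF : Sym2.map g '' F = F')
    (hf : ∀ k, f' k = (f k).map (Sum.map g id)) :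
    IsIsomorphic (rebuild F11 F f) (rebuild F11 F' f') := by
  have hinj : Function.Injective (Sym2.map g) := Sym2.map.injective hg.1.injective
  have hbij : Function.Bijective (Sym2.map g) := Finite.injective_iff_bijective.1 hinj
  refine rebuild_isIsomorphic (Equiv.ofBijective g hg.1) (Equiv.ofBijective _ hbij) (.refl _)
    (.refl _) (fun x => iff_of_true trivial trivial) (fun e x y => ?_) (fun e => ?_) hf
  · rw [F11_isLink_iff, F11_isLink_iff, Equiv.ofBijective_apply, Equiv.ofBijective_apply,
      Equiv.ofBijective_apply, hg.2, ← Sym2.map_mk, hinj.eq_iff]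
  · rw [← hF, Equiv.ofBijective_apply, hinj.mem_set_image]

lemma addLoop_isIsomorphic_of_isSymmetry (hg : IsSymmetry g) {x y a b : F11Vertex}
    (h : s(g x, g y) = s(a, b)) :
    IsIsomorphic (addLoop F11 s(x, y) x y) (addLoop F11 s(a, b) a b) := by
  have key : IsIsomorphic (addLoop F11 s(x, y) x y) (addLoop F11 s(g x, g y) (g x) (g y)) := by
    refine rebuild_isIsomorphic_of_isSymmetry hg (by simp) fun k => ?_
    fin_cases k <;> rfl
  rcases Sym2.eq_iff.1 h with ⟨h1, h2⟩ | ⟨h1, h2⟩ <;> rw [h1, h2] at key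
  · exact key
  · rw [Sym2.eq_swap (a := a)]
    exact key.trans (addLoop_swap _ _ _ _)

lemma addParallel_isIsomorphic_of_isSymmetry (hg : IsSymmetry g) {x y a b : F11Vertex}
    (h : s(g x, g y) = s(a, b)) :
    IsIsomorphic (addParallel F11 s(x, y) x y) (addParallel F11 s(a, b) a b) := by
  have key : IsIsomorphic (addParallel F11 s(x, y) x y)
      (addParallel F11 s(g x, g y) (g x) (g y)) := by
    refine rebuild_isIsomorphic_of_isSymmetry hg (by simp) fun k => ?_
    fin_cases k <;> rfl
  rcases Sym2.eq_iff.1 h with ⟨h1, h2⟩ | ⟨h1, h2⟩ <;> rw [h1, h2] at key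
  · exact key
  · rw [Sym2.eq_swap (a := a)]
    exact key.trans (addParallel_swap _ _ _ _)

lemma F11Chord_swap_left (x₁ y₁ x₂ y₂ : F11Vertex) :
    IsIsomorphic (F11Chord x₁ y₁ x₂ y₂) (F11Chord y₁ x₁ x₂ y₂) := by
  rw [F11Chord, F11Chord, Sym2.eq_swap (a := y₁)]
  exact addChord_swap_left _ _ _ _ _ _ _

lemma F11Chord_comm (x₁ y₁ x₂ y₂ : F11Vertex) :
    IsIsomorphic (F11Chord x₁ y₁ x₂ y₂) (F11Chord x₂ y₂ x₁ y₁) :=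
  addChord_comm _ _ _ _ _ _ _

lemma F11Chord_swap_right (x₁ y₁ x₂ y₂ : F11Vertex) :
    IsIsomorphic (F11Chord x₁ y₁ x₂ y₂) (F11Chord x₁ y₁ y₂ x₂) :=
  (F11Chord_comm _ _ _ _).trans ((F11Chord_swap_left _ _ _ _).trans (F11Chord_comm _ _ _ _))

lemma F11Chord_isIsomorphic_of_eq {x₁ y₁ x₂ y₂ a b c d : F11Vertex}
    (h₁ : s(x₁, y₁) = s(a, b)) (h₂ : s(x₂, y₂) = s(c, d)) :
    IsIsomorphic (F11Chord x₁ y₁ x₂ y₂) (F11Chord a b c d) := by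
  have hleft : IsIsomorphic (F11Chord x₁ y₁ x₂ y₂) (F11Chord a b x₂ y₂) := by
    rcases Sym2.eq_iff.1 h₁ with ⟨rfl, rfl⟩ | ⟨rfl, rfl⟩
    · exact (F11Chord_swap_left _ _ _ _).trans (F11Chord_swap_left _ _ _ _)
    · exact F11Chord_swap_left _ _ _ _
  rcases Sym2.eq_iff.1 h₂ with ⟨rfl, rfl⟩ | ⟨rfl, rfl⟩
  · exact hleft
  · exact hleft.trans (F11Chord_swap_right _ _ _ _)

lemma F11Chord_isIsomorphic_of_isSymmetry (hg : IsSymmetry g) {x₁ y₁ x₂ y₂ a b c d : F11Vertex}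
    (h : s(s(g x₁, g y₁), s(g x₂, g y₂)) = s(s(a, b), s(c, d))) :
    IsIsomorphic (F11Chord x₁ y₁ x₂ y₂) (F11Chord a b c d) := by
  have key : IsIsomorphic (F11Chord x₁ y₁ x₂ y₂) (F11Chord (g x₁) (g y₁) (g x₂) (g y₂)) := by
    refine rebuild_isIsomorphic_of_isSymmetry hg (by simp [Set.image_pair]) fun k => ?_
    fin_cases k <;> rfl
  rcases Sym2.eq_iff.1 h with ⟨h₁, h₂⟩ | ⟨h₁, h₂⟩
  · exact key.trans (F11Chord_isIsomorphic_of_eq h₁ h₂)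
  · exact key.trans ((F11Chord_isIsomorphic_of_eq h₁ h₂).trans (F11Chord_comm _ _ _ _))

end Transfer

/-! ### An isomorphism not induced by a symmetry of F₁₁ -/

section Exceptional

/-- Adjacency in `F₁₁ ∪ (x₁y₁ - x₂y₂)`, in decidable form. -/
lemma F11Chord_adj_iff {x₁ y₁ x₂ y₂ : F11Vertex} {p q : F11Vertex ⊕ Fin 2} :
    (F11Chord x₁ y₁ x₂ y₂).Adj p q ↔
      (∃ z ∈ F11Edges, z ≠ s(x₁, y₁) ∧ z ≠ s(x₂, y₂) ∧ z.map Sum.inl = s(p, q)) ∨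
      s(p, q) ∈ [s(Sum.inl x₁, Sum.inr 0), s(Sum.inr 0, Sum.inl y₁), s(Sum.inl x₂, Sum.inr 1),
        s(Sum.inr 1, Sum.inl y₂), s(Sum.inr 0, Sum.inr 1)] := by
  have hmem : s(p, q) ∈ [s(Sum.inl x₁, Sum.inr 0), s(Sum.inr 0, Sum.inl y₁),
      s(Sum.inl x₂, Sum.inr 1), s(Sum.inr 1, Sum.inl y₂), s(Sum.inr 0, Sum.inr 1)] ↔
      ∃ k, (![s(Sum.inl x₁, Sum.inr 0), s(Sum.inr 0, Sum.inl y₁), s(Sum.inl x₂, Sum.inr 1),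
        s(Sum.inr 1, Sum.inl y₂), s(Sum.inr 0, Sum.inr 1)] : Fin 5 → _) k = s(p, q) := by
    simp only [List.mem_cons, List.not_mem_nil, or_false, Fin.exists_fin_succ, Fin.exists_fin_zero,
      eq_comm (a := s(p, q))]
    rfl
  rw [hmem]
  constructor
  · rintro ⟨z | k, h⟩
    · obtain ⟨hz, x, y, hxy, rfl, rfl⟩ := h
      obtain ⟨rfl, hmem⟩ := F11_isLink_iff.1 hxy
      exact Or.inl ⟨_, hmem, fun h => hz (Or.inl h), fun h => hz (Or.inr h), rfl⟩
    · exact Or.inr ⟨k, h⟩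
  · rintro (⟨z, hz, h1, h2, h⟩ | ⟨k, h⟩)
    · induction z with | h x y => ?_
      have hlink : F11.IsLink s(x, y) x y := F11_isLink_iff.2 ⟨rfl, hz⟩
      have hne : s(x, y) ∉ ({s(x₁, y₁), s(x₂, y₂)} : Set _) := by simp [h1, h2]
      rcases Sym2.eq_iff.1 h with ⟨rfl, rfl⟩ | ⟨rfl, rfl⟩
      · exact ⟨Sum.inl s(x, y), hne, x, y, hlink, rfl, rfl⟩
      · exact ⟨Sum.inl s(x, y), hne, y, x, hlink.symm, rfl, rfl⟩
    · exact ⟨Sum.inr k, h⟩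

instance {x₁ y₁ x₂ y₂ : F11Vertex} {p q : F11Vertex ⊕ Fin 2} :
    Decidable ((F11Chord x₁ y₁ x₂ y₂).Adj p q) :=
  decidable_of_iff' _ F11Chord_adj_iff

/-- Old edges are determined by their ends, and every new edge meets a new vertex. The two halves of
a subdivided edge differ because it is not a loop. -/
lemma F11Chord_edge_unique {x₁ y₁ x₂ y₂ : F11Vertex} (h₁ : x₁ ≠ y₁) (h₂ : x₂ ≠ y₂)
    (e e' : Sym2 F11Vertex ⊕ Fin 5) (p q : F11Vertex ⊕ Fin 2)
    (he : (F11Chord x₁ y₁ x₂ y₂).IsLink e p q) (he' : (F11Chord x₁ y₁ x₂ y₂).IsLink e' p q) :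
    e = e' := by
  have hnew : ∀ k x y, (![s(Sum.inl x₁, Sum.inr 0), s(Sum.inr 0, Sum.inl y₁),
      s(Sum.inl x₂, Sum.inr 1), s(Sum.inr 1, Sum.inl y₂), s(Sum.inr 0, Sum.inr 1)] :
        Fin 5 → Sym2 (F11Vertex ⊕ Fin 2)) k ≠ s(Sum.inl x, Sum.inl y) := by
    intro k x y
    fin_cases k <;> simp
  have hinj : Function.Injective (![s(Sum.inl x₁, Sum.inr 0), s(Sum.inr 0, Sum.inl y₁),
      s(Sum.inl x₂, Sum.inr 1), s(Sum.inr 1, Sum.inl y₂), s(Sum.inr 0, Sum.inr 1)] :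
        Fin 5 → Sym2 (F11Vertex ⊕ Fin 2)) := by
    intro k k'
    fin_cases k <;> fin_cases k' <;> simp [h₁, h₂, h₁.symm, h₂.symm]
  rcases e with z | k <;> rcases e' with z' | k'
  · obtain ⟨-, x, y, hz, rfl, rfl⟩ := he
    obtain ⟨-, x', y', hz', h, h'⟩ := he'
    obtain rfl := Sum.inl.inj h
    obtain rfl := Sum.inl.inj h'
    rw [(F11_isLink_iff.1 hz).1, (F11_isLink_iff.1 hz').1]
  · obtain ⟨-, x, y, -, rfl, rfl⟩ := he
    exact absurd he' (hnew k' x y)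
  · obtain ⟨-, x, y, -, rfl, rfl⟩ := he'
    exact absurd he (hnew k x y)
  · exact congrArg Sum.inr (hinj (Eq.trans he (Eq.symm he')))

lemma mem_vertexSet_F11Chord {x₁ y₁ x₂ y₂ : F11Vertex} (p : F11Vertex ⊕ Fin 2) :
    p ∈ V(F11Chord x₁ y₁ x₂ y₂) := by
  rcases p with x | i
  · exact Or.inl (Or.inl ⟨x, trivial, rfl⟩)
  · exact Or.inl (Or.inr ⟨i, rfl⟩)

/-- The vertex map of an isomorphism from `F₁₁ ∪ (A2 - A'7)` to `F₁₁ ∪ (AA' - 18)` that does not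
come from a symmetry of `F₁₁`. -/
def exceptionalMap : F11Vertex ⊕ Fin 2 → F11Vertex ⊕ Fin 2
  | .inr 0 => .inl n1
  | .inl n1 => .inl A
  | .inl A => .inr 1
  | .inr 1 => .inl A'
  | .inl A' => .inr 0
  | p => p

/-- The vertex map of the isomorphism from `F₁₁ ∪ (AA' - 18)` to `F₁₁ ∪ (A2 - A'7)` that is inverse
to `exceptionalMap`. -/
def exceptionalInv : F11Vertex ⊕ Fin 2 → F11Vertex ⊕ Fin 2
  | .inl n1 => .inr 0
  | .inl A => .inl n1
  | .inr 1 => .inl A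
  | .inl A' => .inr 1
  | .inr 0 => .inl A'
  | p => p

/-- Restoring 27 in the copy on A, A', 1, 2, 7, 8 turns either chord into a chord between two
disjoint edges of K₃,₃. The map permutes A, A', 1 and the two new vertices cyclically, and fixes 2
and 7, where the copy is attached to the rest. -/
lemma F11Chord_isIsomorphic_H1 : IsIsomorphic (F11Chord A n2 A' n7) H1 := by
  refine isIsomorphic_of_adj (F11Chord_edge_unique (by decide) (by decide))
    (F11Chord_edge_unique (by decide) (by decide))
    ⟨exceptionalMap, exceptionalInv, by decide, by decide⟩
    (fun p => iff_of_true (mem_vertexSet_F11Chord p) (mem_vertexSet_F11Chord _)) ?_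
  have h : ∀ p q, (F11Chord A n2 A' n7).Adj p q ↔
      (F11Chord A A' n1 n8).Adj (exceptionalMap p) (exceptionalMap q) := by
    decide +kernel
  exact h

end Exceptional

/-! ### A drawing of `F₁₁` on the torus -/

open F11Vertex Step

/-- The grid points of the vertices of `F₁₁`. -/
def position : F11Vertex → ℤ × ℤ
  | n1 => (2, 0) | n2 => (4, 0) | n3 => (6, 0) | n4 => (8, 0)
  | n8 => (2, 2) | A => (4, 2) | B => (6, 2) | n5 => (8, 2)
  | n7 => (2, 4) | B' => (6, 4) | n6 => (8, 4) | A' => (2, 8)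

/-- The edges of `F₁₁` drawn as walks in the grid. -/
def edgeWalks : List (F11Vertex × F11Vertex × List Step) :=
  [(A, A', [u, u, u, u, u, u, l, l]), (B, B', [u, u]), (A, n8, [l, l]), (A', n1, [u, u]),
   (B, n5, [r, r]), (B', n4, [u, u, u, u, r, r, u, u]), (n4, n5, [u, u]), (n1, n8, [u, u]),
   (A, n2, [d, d]), (n7, A', [u, u, u, u]), (B, n3, [d, d]), (B', n6, [r, r]), (n1, n2, [r, r]),
   (n3, n4, [r, r]), (n5, n6, [u, u]), (n7, n8, [d, d]), (n2, n3, [r, r]), (n7, n6, [l, l, l, l])]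

/-- The walk along which the edge from `x` to `y` is drawn. -/
def edgeWalk (x y : F11Vertex) : List Step :=
  ((edgeWalks.find? fun r => r.1 = x ∧ r.2.1 = y).map fun r => r.2.2).getD []

/-- The vertices of the graphs `F₁₁ ∪ e`. -/
def allVertices : List (F11Vertex ⊕ Fin 2) :=
  [A, A', B, B', n1, n2, n3, n4, n5, n6, n7, n8].map Sum.inl ++ [Sum.inr 0, Sum.inr 1]

lemma mem_allVertices (x : F11Vertex ⊕ Fin 2) : x ∈ allVertices := by
  rcases x with x | i
  · cases x <;> simp [allVertices]
  · fin_cases i <;> simp [allVertices]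

/-- The routes of the edges of `F₁₁` that are not in `F`, together with those of the new edges. -/
def extendedRoutes (F : List (Sym2 F11Vertex)) {n : ℕ}
    (new : Fin n → (F11Vertex ⊕ Fin 2) × (F11Vertex ⊕ Fin 2) × List Step) :
    List (Route (F11Vertex ⊕ Fin 2) (Sym2 F11Vertex ⊕ Fin n)) :=
  (edgeWalks.filter fun r => s(r.1, r.2.1) ∉ F).map
    (fun r => ⟨Sum.inl s(r.1, r.2.1), Sum.inl r.1, Sum.inl r.2.1, r.2.2⟩) ++
  List.ofFn fun k => ⟨Sum.inr k, (new k).1, (new k).2.1, (new k).2.2⟩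

lemma exists_mem_edgeWalks : ∀ z ∈ F11Edges, ∃ r ∈ edgeWalks, s(r.1, r.2.1) = z := by
  decide +kernel

/-- `F` is a decidable stand-in for the set `F'` of deleted edges. One inclusion suffices, since
superfluous routes do no harm. -/
theorem toroidal_rebuild_F11 {F : List (Sym2 F11Vertex)} {F' : Set (Sym2 F11Vertex)} {n : ℕ}
    {f : Fin n → Sym2 (F11Vertex ⊕ Fin 2)} {p : Fin 2 → ℤ × ℤ}
    {new : Fin n → (F11Vertex ⊕ Fin 2) × (F11Vertex ⊕ Fin 2) × List Step}
    (hF : ∀ z ∈ F, z ∈ F')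
    (hf : ∀ k, f k = s((new k).1, (new k).2.1))
    (h : IsGridDrawing 10 (Sum.elim position p) allVertices (extendedRoutes F new)) :
    Toroidal (rebuild F11 F' f) := by
  refine toroidal_of_isGridDrawing (by norm_num) (fun x _ => mem_allVertices x) ?_ h
  rintro (z | k) he
  · obtain ⟨p, q, hz, x, y, hxy, -⟩ := (rebuild F11 F' f).exists_isLink_of_mem_edgeSet he
    obtain ⟨rfl, hmem⟩ := F11_isLink_iff.1 hxy
    obtain ⟨r, hr, hre⟩ := exists_mem_edgeWalks _ hmem
    rw [← hre] at hz hmem ⊢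
    refine ⟨⟨Sum.inl s(r.1, r.2.1), Sum.inl r.1, Sum.inl r.2.1, r.2.2⟩,
      List.mem_append_left _ (List.mem_map.2 ⟨r, List.mem_filter.2 ⟨hr, ?_⟩, rfl⟩), rfl,
      hz, r.1, r.2.1, F11_isLink_iff.2 ⟨rfl, hmem⟩, rfl, rfl⟩
    exact decide_eq_true fun h => hz (hF _ h)
  · exact ⟨⟨Sum.inr k, (new k).1, (new k).2.1, (new k).2.2⟩,
      List.mem_append_right _ (List.mem_ofFn.2 ⟨k, rfl⟩), rfl, hf k⟩

/-- Here and in the next two theorems the numbers tell after how many steps the old walks are cut by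
the new vertices, and the words are the walks of the added edges. The ends must be given in the
order of `edgeWalks`: otherwise `edgeWalk` is empty and the drawing is rejected. -/
theorem toroidal_addLoop (x y : F11Vertex) (i : ℕ) (w w' : List Step)
    (h : IsGridDrawing 10 (Sum.elim position ![walk (position x) (edgeWalk x y) i,
        walk (walk (position x) (edgeWalk x y) i) w w.length]) allVertices
      (extendedRoutes [s(x, y)] ![(.inl x, .inr 0, (edgeWalk x y).take i),
        (.inr 0, .inl y, (edgeWalk x y).drop i), (.inr 0, .inr 1, w), (.inr 1, .inr 1, w')])) :
    Toroidal (addLoop F11 s(x, y) x y) := by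
  refine toroidal_rebuild_F11 (by simp) (fun k => ?_) h
  fin_cases k <;> rfl

theorem toroidal_addParallel (x y : F11Vertex) (i j : ℕ) (w : List Step)
    (h : IsGridDrawing 10 (Sum.elim position ![walk (position x) (edgeWalk x y) i,
        walk (position x) (edgeWalk x y) (i + j)]) allVertices
      (extendedRoutes [s(x, y)] ![(.inl x, .inr 0, (edgeWalk x y).take i),
        (.inr 0, .inr 1, ((edgeWalk x y).drop i).take j),
        (.inr 1, .inl y, (edgeWalk x y).drop (i + j)), (.inr 0, .inr 1, w)])) :
    Toroidal (addParallel F11 s(x, y) x y) := by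
  refine toroidal_rebuild_F11 (by simp) (fun k => ?_) h
  fin_cases k <;> rfl

theorem toroidal_F11Chord (x₁ y₁ : F11Vertex) (i : ℕ) (x₂ y₂ : F11Vertex) (j : ℕ) (w : List Step)
    (h : IsGridDrawing 10 (Sum.elim position ![walk (position x₁) (edgeWalk x₁ y₁) i,
        walk (position x₂) (edgeWalk x₂ y₂) j]) allVertices
      (extendedRoutes [s(x₁, y₁), s(x₂, y₂)] ![(.inl x₁, .inr 0, (edgeWalk x₁ y₁).take i),
        (.inr 0, .inl y₁, (edgeWalk x₁ y₁).drop i), (.inl x₂, .inr 1, (edgeWalk x₂ y₂).take j),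
        (.inr 1, .inl y₂, (edgeWalk x₂ y₂).drop j), (.inr 0, .inr 1, w)])) :
    Toroidal (F11Chord x₁ y₁ x₂ y₂) := by
  refine toroidal_rebuild_F11 (by simp) (fun k => ?_) h
  fin_cases k <;> rfl

/-- The representatives B'4, 7A' and 76 of the three edge orbits are those with long walks and free
space beside them. -/
lemma toroidal_addLoop_of_mem_F11Edges {x y : F11Vertex} (h : s(x, y) ∈ F11Edges) :
    Toroidal (addLoop F11 s(x, y) x y) := by
  obtain ⟨b₆, b₅, b₄, b₃, b₂, b₁, hg⟩ := exists_symmetry_edge _ h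
  have hsymm := isSymmetry_symmetry b₁ b₂ b₃ b₄ b₅ b₆
  rw [Sym2.map_mk] at hg
  simp only [List.mem_cons, List.not_mem_nil, or_false] at hg
  rcases hg with hg | hg | hg <;>
    refine Toroidal.of_isIsomorphic (addLoop_isIsomorphic_of_isSymmetry hsymm hg) ?_
  · exact toroidal_addLoop B' n4 2 [r] [r, u, l, d] (by decide +kernel)
  · exact toroidal_addLoop n7 A' 1 [l] [l, u, r, d] (by decide +kernel)
  · exact toroidal_addLoop n7 n6 3 [u] [r, u, l, d] (by decide +kernel)

lemma toroidal_addParallel_of_mem_F11Edges {x y : F11Vertex} (h : s(x, y) ∈ F11Edges) :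
    Toroidal (addParallel F11 s(x, y) x y) := by
  obtain ⟨b₆, b₅, b₄, b₃, b₂, b₁, hg⟩ := exists_symmetry_edge _ h
  have hsymm := isSymmetry_symmetry b₁ b₂ b₃ b₄ b₅ b₆
  rw [Sym2.map_mk] at hg
  simp only [List.mem_cons, List.not_mem_nil, or_false] at hg
  rcases hg with hg | hg | hg <;>
    refine Toroidal.of_isIsomorphic (addParallel_isIsomorphic_of_isSymmetry hsymm hg) ?_
  · exact toroidal_addParallel B' n4 1 2 [r, u, u, l] (by decide +kernel)
  · exact toroidal_addParallel n7 A' 1 2 [r, u, u, l] (by decide +kernel)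
  · exact toroidal_addParallel n7 n6 1 2 [u, l, l, d] (by decide +kernel)

/-- Both dichotomies are needed only in the weak sense: neither non-toroidality of the exceptional
graphs nor the girth of the ten graphs enters. -/
lemma F11Chord_of_mem_edgePairs {x₁ y₁ x₂ y₂ : F11Vertex} (h : (x₁, y₁, x₂, y₂) ∈ edgePairs) :
    ((∃ H ∈ [H1, H2, H3, H4], IsIsomorphic (F11Chord x₁ y₁ x₂ y₂) H) ∨
      Toroidal (F11Chord x₁ y₁ x₂ y₂)) ∧
    (F11Chord x₁ y₁ x₂ y₂ ∈ F11Cases ∨ HasCycle (F11Chord x₁ y₁ x₂ y₂) 3) := by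
  have refl : ∀ a b c d, IsIsomorphic (F11Chord a b c d) (F11Chord a b c d) :=
    fun _ _ _ _ => F11Chord_isIsomorphic_of_eq rfl rfl
  simp only [edgePairs, List.mem_cons, List.not_mem_nil, or_false, Prod.mk.injEq] at h
  rcases h with ⟨rfl, rfl, rfl, rfl⟩ | ⟨rfl, rfl, rfl, rfl⟩ | ⟨rfl, rfl, rfl, rfl⟩ |
    ⟨rfl, rfl, rfl, rfl⟩ | ⟨rfl, rfl, rfl, rfl⟩ | ⟨rfl, rfl, rfl, rfl⟩ | ⟨rfl, rfl, rfl, rfl⟩ |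
    ⟨rfl, rfl, rfl, rfl⟩ | ⟨rfl, rfl, rfl, rfl⟩ | ⟨rfl, rfl, rfl, rfl⟩ | ⟨rfl, rfl, rfl, rfl⟩ |
    ⟨rfl, rfl, rfl, rfl⟩ | ⟨rfl, rfl, rfl, rfl⟩ | ⟨rfl, rfl, rfl, rfl⟩
  · exact ⟨Or.inr (toroidal_F11Chord A A' 1 B B' 1 [r, r] (by decide +kernel)),
      Or.inl (by simp [F11Cases])⟩
  · exact ⟨Or.inr (toroidal_F11Chord A A' 1 B n3 1 [r, d, d, r] (by decide +kernel)),
      Or.inl (by simp [F11Cases])⟩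
  · exact ⟨Or.inr (toroidal_F11Chord A A' 7 n1 n2 1 [u, u] (by decide +kernel)),
      Or.inl (by simp [F11Cases])⟩
  · exact ⟨Or.inr (toroidal_F11Chord A A' 6 n2 n3 1 [r, u, u] (by decide +kernel)),
      Or.inl (by simp [F11Cases])⟩
  · exact ⟨Or.inl ⟨H1, by simp, refl _ _ _ _⟩, Or.inl (by simp [F11Cases])⟩
  · exact ⟨Or.inl ⟨H1, by simp, F11Chord_isIsomorphic_H1⟩, Or.inl (by simp [F11Cases])⟩
  · exact ⟨Or.inr (toroidal_F11Chord A n2 1 B n3 1 [r, r] (by decide +kernel)),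
      Or.inl (by simp [F11Cases])⟩
  · exact ⟨Or.inl ⟨H4, by simp, refl _ _ _ _⟩, Or.inl (by simp [F11Cases])⟩
  · exact ⟨Or.inl ⟨H2, by simp, refl _ _ _ _⟩, Or.inl (by simp [F11Cases])⟩
  · exact ⟨Or.inl ⟨H3, by simp, refl _ _ _ _⟩, Or.inl (by simp [F11Cases])⟩
  · exact ⟨Or.inr (toroidal_F11Chord A A' 1 A n8 1 [l, d] (by decide +kernel)),
      Or.inr (hasCycle_addChord _ _ _ _ _ _)⟩
  · exact ⟨Or.inr (toroidal_F11Chord A A' 1 A n2 1 [r, d, d, l] (by decide +kernel)),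
      Or.inr (hasCycle_addChord _ _ _ _ _ _)⟩
  · exact ⟨Or.inr (toroidal_F11Chord n7 A' 1 n7 n8 1 [r, d, d, l] (by decide +kernel)),
      Or.inr (hasCycle_addChord _ _ _ _ _ _)⟩
  · exact ⟨Or.inr (toroidal_F11Chord n7 A' 1 n7 n6 1 [l, d] (by decide +kernel)),
      Or.inr (hasCycle_addChord _ _ _ _ _ _)⟩

end CubicTorus

theorem mainTheorem6 {α β : Type*} (K : Graph α β)
    (hK : CubicTorus.IsEdgeAddition CubicTorus.F11 K) :
    ((¬ ∃ H ∈ [CubicTorus.H1, CubicTorus.H2, CubicTorus.H3, CubicTorus.H4],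
        CubicTorus.IsIsomorphic K H) → CubicTorus.Toroidal K) ∧
    (4 ≤ CubicTorus.girth K → ∃ H ∈ CubicTorus.F11Cases, CubicTorus.IsIsomorphic K H) := by
  open CubicTorus in
  rcases hK with ⟨e, x, y, hlink, hK⟩ | ⟨e, x, y, hlink, hK⟩ |
    ⟨e₁, x₁, y₁, e₂, x₂, y₂, h₁, h₂, hne, hK⟩
  · obtain ⟨rfl, he⟩ := F11_isLink_iff.1 hlink
    exact ⟨fun _ => .of_isIsomorphic hK (toroidal_addLoop_of_mem_F11Edges he), fun h =>
      absurd h (girth_lt_four le_rfl (by norm_num)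
        (.of_isIsomorphic hK (hasCycle_addLoop _ _ _ _)))⟩
  · obtain ⟨rfl, he⟩ := F11_isLink_iff.1 hlink
    exact ⟨fun _ => .of_isIsomorphic hK (toroidal_addParallel_of_mem_F11Edges he), fun h =>
      absurd h (girth_lt_four (by norm_num) (by norm_num)
        (.of_isIsomorphic hK (hasCycle_addParallel _ _ _ _)))⟩
  · obtain ⟨rfl, he₁⟩ := F11_isLink_iff.1 h₁
    obtain ⟨rfl, he₂⟩ := F11_isLink_iff.1 h₂
    obtain ⟨g, hg, ⟨a, b, c, d⟩, hr, hgr⟩ := exists_symmetry_edgePair he₁ he₂ hne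
    have hiso := hK.trans (F11Chord_isIsomorphic_of_isSymmetry hg hgr)
    obtain ⟨htorus, hcycle⟩ := F11Chord_of_mem_edgePairs hr
    refine ⟨fun hH => ?_, fun hgirth => ?_⟩
    · rcases htorus with ⟨H, hmem, h⟩ | h
      · exact absurd ⟨H, hmem, hiso.trans h⟩ hH
      · exact .of_isIsomorphic hiso h
    · rcases hcycle with h | h
      · exact ⟨_, h, hiso⟩
      · exact absurd hgirth (girth_lt_four (by norm_num) (by norm_num) (.of_isIsomorphic hiso h))
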